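/- For $a\in\mathbb{R}$ and $n\ge 0$ let $(a)_n=a(a+1)\cdots(a+n-1)$, with $(a)_0=1$, and for every integer $n\ge 0$ put $$F_n(x)=\sum_{j=0}^{\nu}(-4)^{j-\nu}\,\frac{(2\nu-2j+1)_n}{(2j-2\nu+n)!}\,x^j,\qquad \nu=\lfloor n/2\rfloor .$$ For every $n\ge 0$ each of the polynomials $F_{2n}$ and $F_{2n+1}$ has exactly $n$ complex roots; these are all real and simple. Let $\lambda^{(0)}_{n,1}<\dots<\lambda^{(0)}_{n,n}$ be the roots of $F_{2n}$ and $\lambda^{(1)}_{n,1}<\dots<\lambda^{(1)}_{n,n}$ the roots of $F_{2n+1}$. Then for every fixed integer $k\ge 1$ $$\lim_{n\to\infty}\lambda^{(0)}_{n,k}=\bigl(k-\tfrac12\bigr)^2\pi^2\qquad\text{and}\qquad \lim_{n\to\infty}\lambda^{(1)}_{n,k}=k^2\pi^2 .$$ Moreover $F_n(0)\ne 0$ for all $n\ge 0$, and for every fixed $j\ge 0$ the coefficient of $x^j$ in the normalized polynomial $F_{2n}(x)/F_{2n}(0)$ tends to $\frac{(-1)^j}{(2j)!}$ and that in $F_{2n+1}(x)/F_{2n+1}(0)$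 tends to $\frac{(-1)^j}{(2j+1)!}$ as $n\to\infty$. For all $x\in\mathbb{C}$ the limiting power series satisfy $$\sum_{j=0}^\infty\frac{(-1)^j}{(2j)!}x^j=\cos(\sqrt x),\qquad \sum_{j=0}^\infty\frac{(-1)^j}{(2j+1)!}x^j=\frac{\sin(\sqrt x)}{\sqrt x},$$ where $\sqrt x$ is any square root of $x$ and the last quotient is read as $1$ at $x=0$. -/

import Mathlib

open Polynomial Filter Topology

/-- The monic real polynomial
`F_n(x) = ∑_{j=0}^{ν} (-4)^{j-ν} (2ν-2j+1)_n / (2j-2ν+n)! x^j`, where `ν = ⌊n/2⌋` and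
`(a)_n` is the rising factorial. Since `2ν ≤ n`, the subtraction of natural numbers
under the factorial is a genuine one. -/
noncomputable def polyF (n : ℕ) : ℝ[X] :=
  ∑ j ∈ Finset.range (n / 2 + 1),
    C ((-4 : ℝ) ^ ((j : ℤ) - ((n / 2 : ℕ) : ℤ)) *
      (ascPochhammer ℝ n).eval (2 * ((n / 2 : ℕ) : ℝ) - 2 * (j : ℝ) + 1) /
      ((2 * j + n - 2 * (n / 2)).factorial : ℝ)) * X ^ j

/-- `r 1 < r 2 < ... < r m` are all the (complex) roots of the nonzero real polynomial `p`,
listed in increasing order: all of them are real and simple, and there are exactly `m`.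
The values of `r` outside `{1, ..., m}` are irrelevant. -/
structure IsIncreasingRoots (p : ℝ[X]) (m : ℕ) (r : ℕ → ℝ) : Prop where
  ne_zero : p ≠ 0
  strictMonoOn : StrictMonoOn r (Set.Icc 1 m)
  eq_prod : p = C p.leadingCoeff * ∏ k ∈ Finset.Icc 1 m, (X - C (r k))

/-! The reverse Bessel polynomials satisfy θ_{N+2} = (2N+3) θ_{N+1} + z² θ_N. Up to sign, F_n
collects the coefficients of θ_n of the same parity as n, with z² = -x (`polyF_eq`). The sections
therefore satisfy P_{k+2} = a_k P_{k+1} - x P_k with a_k > 0.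

Put x = s⁻² and m_k = s P_{k+1}/P_k; then m_{k+1} = a_k s - 1/m_k. This map keeps the upper
half-plane, so no root has nonreal s (`three_term_im_pos`). Along real s the derivative of m_k is
positive, so positive roots are simple (`three_term_wronskian_pos`).

The normalized coefficients converge and are dominated by 1/(2j)!. Hence F_n/F_n(0) and its image
under x d/dx converge, even at moving points, to cos √x or sin √x/√x and their images.
`tendsto_increasingRoots` turns this into convergence of roots: a sign change forces a root near
each zero of the limit, and Rolle's theorem forbids two roots from merging at a simple zero. -/

/-! ### Coefficients of reverse Bessel polynomials -/

/-- The coefficient of `z ^ i` in the reverse Bessel polynomial of degree `N`. -/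
noncomputable def besselCoeff (N i : ℕ) : ℝ :=
  if i ≤ N then ((2 * N - i).factorial : ℝ) / ((N - i).factorial * i.factorial * 2 ^ (N - i)) else 0

lemma besselCoeff_of_le {N i : ℕ} (h : i ≤ N) : besselCoeff N i =
    ((2 * N - i).factorial : ℝ) / ((N - i).factorial * i.factorial * 2 ^ (N - i)) := if_pos h

lemma besselCoeff_of_lt {N i : ℕ} (h : N < i) : besselCoeff N i = 0 := if_neg (by omega)

lemma besselCoeff_add_left (d i : ℕ) : besselCoeff (i + d) i =
    ((2 * d + i).factorial : ℝ) / (d.factorial * i.factorial * 2 ^ d) := by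
  rw [besselCoeff_of_le (by omega), show 2 * (i + d) - i = 2 * d + i by omega,
    show i + d - i = d by omega]

lemma besselCoeff_pos {N i : ℕ} (h : i ≤ N) : 0 < besselCoeff N i := by
  rw [besselCoeff_of_le h]; positivity

lemma besselCoeff_nonneg (N i : ℕ) : 0 ≤ besselCoeff N i := by
  rcases le_or_gt i N with h | h
  · exact (besselCoeff_pos h).le
  · rw [besselCoeff_of_lt h]

/-- The ratio of consecutive coefficients with denominators cleared; both the uniform bound and the
limit come from it. Writing N = i + d avoids truncated subtraction. -/
lemma besselCoeff_succ_mul (d i : ℕ) :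
    besselCoeff (i + d) (i + 1) * ((i + 1) * (i + 2 * d)) = 2 * d * besselCoeff (i + d) i := by
  cases d with
  | zero => simp [besselCoeff_of_lt]
  | succ d =>
    rw [besselCoeff_add_left, show i + (d + 1) = (i + 1) + d by ring, besselCoeff_add_left,
      show 2 * (d + 1) + i = (2 * d + (i + 1)) + 1 by ring]
    simp only [Nat.factorial_succ]
    push_cast
    field_simp
    ring

lemma besselCoeff_recurrence (N i : ℕ) : besselCoeff (N + 2) (i + 2) =
    (2 * N + 3) * besselCoeff (N + 1) (i + 2) + besselCoeff N i := by
  rcases lt_trichotomy N i with h | h | h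
  · simp [besselCoeff_of_lt, h, show N + 1 < i + 2 by omega]
  · subst h
    rw [besselCoeff_of_lt (show N + 1 < N + 2 by omega), besselCoeff_of_le le_rfl,
      besselCoeff_of_le le_rfl]
    simp only [show 2 * (N + 2) - (N + 2) = N + 2 by omega, show 2 * N - N = N by omega]
    simp [Nat.factorial_ne_zero]
  · obtain ⟨d, rfl⟩ := Nat.exists_eq_add_of_lt h
    rw [show i + d + 1 + 2 = (i + 2) + (d + 1) by ring, show i + d + 1 + 1 = (i + 2) + d by ring,
      show i + d + 1 = i + (d + 1) by ring, besselCoeff_add_left, besselCoeff_add_left,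
      besselCoeff_add_left, show 2 * (d + 1) + (i + 2) = (2 * d + i + 2) + 2 by ring,
      show 2 * (d + 1) + i = 2 * d + i + 2 by ring, show 2 * d + (i + 2) = 2 * d + i + 2 by ring]
    simp only [Nat.factorial_succ]
    push_cast
    field_simp
    ring

lemma besselCoeff_recurrence_zero (N : ℕ) :
    besselCoeff (N + 2) 0 = (2 * N + 3) * besselCoeff (N + 1) 0 := by
  rw [besselCoeff_of_le (by omega), besselCoeff_of_le (by omega)]
  simp only [Nat.sub_zero, show 2 * (N + 2) = 2 * (N + 1) + 2 by ring, Nat.factorial_succ]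
  push_cast
  field_simp
  ring

lemma besselCoeff_recurrence_one (N : ℕ) :
    besselCoeff (N + 2) 1 = (2 * N + 3) * besselCoeff (N + 1) 1 := by
  rw [show N + 2 = 1 + (N + 1) by ring, show N + 1 = 1 + N by ring, besselCoeff_add_left,
    show 1 + N = N + 1 by ring, show 2 * (N + 1) + 1 = (2 * N + 1) + 2 by ring]
  rw [show N + 1 = 1 + N by ring, besselCoeff_add_left, show 1 + N = N + 1 by ring]
  simp only [Nat.factorial_succ]
  push_cast
  field_simp
  ring

lemma besselCoeff_succ_le (N i : ℕ) (hN : 1 ≤ N) :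
    besselCoeff N (i + 1) ≤ besselCoeff N i / (i + 1) := by
  rcases le_or_gt i N with h | h
  · obtain ⟨d, rfl⟩ := Nat.exists_eq_add_of_le h
    have h1 := besselCoeff_succ_mul d i
    have h2 := besselCoeff_nonneg (i + d) i
    -- This is where N ≥ 1 enters: at N = 0 the factor i + 2d would vanish.
    have h3 : (0 : ℝ) < i + 2 * d := by exact_mod_cast (by omega : 0 < i + 2 * d)
    rw [le_div_iff₀ (by positivity)]
    refine le_of_mul_le_mul_right ?_ h3
    rw [mul_assoc, h1]
    have : (0 : ℝ) ≤ i := by positivity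
    nlinarith
  · rw [besselCoeff_of_lt (show N < i + 1 by omega)]
    exact div_nonneg (besselCoeff_nonneg _ _) (by positivity)

lemma besselCoeff_le (N e i : ℕ) (hN : 1 ≤ N) :
    besselCoeff N (i + e) ≤ besselCoeff N e * (e.factorial / (i + e).factorial) := by
  induction i with
  | zero => simp [Nat.factorial_ne_zero]
  | succ i ih =>
    rw [show i + 1 + e = (i + e) + 1 by ring]
    refine (besselCoeff_succ_le N (i + e) hN).trans ?_
    rw [Nat.factorial_succ, div_le_iff₀ (by positivity)]
    refine ih.trans (le_of_eq ?_)
    push_cast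
    field_simp

lemma tendsto_besselCoeff_ratio (e i : ℕ) :
    Tendsto (fun N ↦ besselCoeff N (i + e) / besselCoeff N e) atTop
      (𝓝 (e.factorial / (i + e).factorial)) := by
  induction i with
  | zero =>
    have : ((e.factorial : ℝ) / (0 + e).factorial) = 1 := by simp [Nat.factorial_ne_zero]
    rw [this]
    refine tendsto_const_nhds.congr' ?_
    filter_upwards [eventually_ge_atTop e] with N hN
    rw [zero_add, div_self (besselCoeff_pos hN).ne']
  | succ i ih =>
    -- The ratio factor 2(N - i - e)/(2N - i - e), divided through by N.
    have key : Tendsto (fun N : ℕ ↦ (2 * (1 - ((i + e : ℕ) : ℝ) / N)) /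
        (2 - ((i + e : ℕ) : ℝ) / N)) atTop (𝓝 ((2 * (1 - 0)) / (2 - 0))) := by
      have h0 := tendsto_const_div_atTop_nhds_zero_nat (((i + e : ℕ) : ℝ))
      exact (tendsto_const_nhds.mul (tendsto_const_nhds.sub h0)).div
        (tendsto_const_nhds.sub h0) (by norm_num)
    have h := (ih.mul key).div_const ((i + e : ℕ) + 1 : ℝ)
    convert h.congr' ?_ using 2
    · rw [show i + 1 + e = (i + e) + 1 by ring, Nat.factorial_succ]
      push_cast
      field_simp
      norm_num
    · filter_upwards [eventually_ge_atTop (i + e + 1)] with N hN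
      obtain ⟨d, rfl⟩ := Nat.exists_eq_add_of_le (show i + e ≤ N by omega)
      have h1 := besselCoeff_succ_mul d (i + e)
      have h3 : (0 : ℝ) < (i + e : ℕ) + 2 * d := by exact_mod_cast (by omega : 0 < i + e + 2 * d)
      have h4 : (0 : ℝ) < (i + e + d : ℕ) := by exact_mod_cast (by omega : 0 < i + e + d)
      have h5 : (2 * (1 - ((i + e : ℕ) : ℝ) / ((i + e + d : ℕ) : ℝ))) /
          (2 - ((i + e : ℕ) : ℝ) / (i + e + d : ℕ)) = 2 * d / ((i + e : ℕ) + 2 * d) := by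
        have h6 : (1 - ((i + e : ℕ) : ℝ) / ((i + e + d : ℕ) : ℝ)) = d / ((i + e + d : ℕ) : ℝ) := by
          rw [eq_div_iff h4.ne', sub_mul, div_mul_cancel₀ _ h4.ne']
          push_cast; ring
        have h7 : (2 - ((i + e : ℕ) : ℝ) / ((i + e + d : ℕ) : ℝ)) =
            ((i + e : ℕ) + 2 * d) / ((i + e + d : ℕ) : ℝ) := by
          rw [eq_div_iff h4.ne', sub_mul, div_mul_cancel₀ _ h4.ne']
          push_cast; ring
        rw [h6, h7, ← mul_div_assoc, div_div_div_cancel_right₀ h4.ne']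
      have h8 : besselCoeff (i + e + d) (i + e + 1) =
          2 * d * besselCoeff (i + e + d) (i + e) / (((i + e : ℕ) + 1) * ((i + e : ℕ) + 2 * d)) := by
        rw [← h1]
        field_simp
      rw [h5, show i + 1 + e = i + e + 1 by ring, h8]
      have h9 := (besselCoeff_pos (show e ≤ i + e + d by omega)).ne'
      field_simp

/-! ### F_n as a section of a reverse Bessel polynomial -/

/-- With d = m - j, this rests on (2d+1)_n = (2d+n)!/(2d)! and (-4)^(-d) = (-1)^d 2^(-2d). The
parity of the index is carried by e. -/
lemma polyF_coeff {e : ℕ} (he : e < 2) (m j : ℕ) :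
    (polyF (2 * m + e)).coeff j = (-1) ^ (m + j) * besselCoeff (2 * m + e) (2 * j + e) := by
  have hm : (2 * m + e) / 2 = m := by omega
  rw [polyF, hm, finsetSum_coeff]
  simp only [coeff_C_mul_X_pow]
  rw [Finset.sum_ite_eq]
  split_ifs with h
  · obtain ⟨d, rfl⟩ := Nat.exists_eq_add_of_le (show j ≤ m by simpa [Nat.lt_succ_iff] using h)
    rw [show 2 * (j + d) + e = (2 * j + e) + 2 * d by ring, besselCoeff_add_left,
      show 2 * ((j + d : ℕ) : ℝ) - 2 * j + 1 = ((2 * d : ℕ) : ℝ) + 1 by push_cast; ring,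
      show 2 * j + (2 * j + e + 2 * d) - 2 * (j + d) = 2 * j + e by omega,
      show (j : ℤ) - ((j + d : ℕ) : ℤ) = -(d : ℤ) by push_cast; ring, zpow_neg, zpow_natCast]
    have h1 := factorial_mul_ascPochhammer ℝ (2 * d) (2 * j + e + 2 * d)
    rw [show 2 * d + (2 * j + e + 2 * d) = 2 * (2 * d) + (2 * j + e) by ring] at h1
    rw [← h1, pow_mul, show j + d + j = 2 * j + d by ring, pow_add, pow_mul]
    have h2 : (-4 : ℝ) ^ d = (-1) ^ d * (2 ^ 2) ^ d := by rw [← mul_pow]; norm_num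
    have h3 : ((-1 : ℝ) ^ d)⁻¹ = (-1) ^ d := by
      rw [← inv_pow]; norm_num
    rw [h2, mul_inv, h3]
    field_simp
    norm_num
  · rw [besselCoeff_of_lt, mul_zero]
    simp at h; omega

/-- The polynomial `∑ j, (-1) ^ j b_{N, 2j+e} x ^ j` formed from every second coefficient of the
reverse Bessel polynomial of degree `N`. -/
noncomputable def besselSection (e N : ℕ) : ℝ[X] :=
  ∑ j ∈ Finset.range (N + 1), C ((-1) ^ j * besselCoeff N (2 * j + e)) * X ^ j

lemma besselSection_coeff (e N j : ℕ) :
    (besselSection e N).coeff j = (-1) ^ j * besselCoeff N (2 * j + e) := by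
  rw [besselSection, finsetSum_coeff]
  simp only [coeff_C_mul_X_pow]
  rw [Finset.sum_ite_eq]
  split_ifs with h
  · rfl
  · rw [besselCoeff_of_lt, mul_zero]
    simp at h; omega

lemma besselSection_recurrence {e : ℕ} (he : e < 2) (N : ℕ) : besselSection e (N + 2) =
    C (2 * (N : ℝ) + 3) * besselSection e (N + 1) - X * besselSection e N := by
  ext j
  rw [coeff_sub, coeff_C_mul]
  cases j with
  | zero =>
    simp only [besselSection_coeff, coeff_X_mul_zero]
    interval_cases e
    · simpa using besselCoeff_recurrence_zero N
    · simpa using besselCoeff_recurrence_one N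
  | succ j =>
    rw [coeff_X_mul]
    simp only [besselSection_coeff]
    rw [show 2 * (j + 1) + e = (2 * j + e) + 2 by ring, besselCoeff_recurrence]
    ring

lemma polyF_eq {e : ℕ} (he : e < 2) (m : ℕ) :
    polyF (2 * m + e) = C ((-1) ^ m) * besselSection e (2 * m + e) := by
  ext j
  rw [polyF_coeff he, coeff_C_mul, besselSection_coeff, pow_add, mul_assoc]

/-! ### Roots of polynomials given by a three-term recurrence -/

section ThreeTerm
variable {P : ℕ → ℝ[X]} {a : ℕ → ℝ} {c : ℝ}

/-- The quantity is |P_k|² Im m_k for m_k = s P_{k+1}/P_k, so the induction is m ↦ a s - 1/m on the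
upper half-plane, written without division. -/
lemma three_term_im_pos (h0 : P 0 = 1) (h1 : P 1 = C c) (hc : 0 < c) (ha : ∀ k, 0 < a k)
    (hrec : ∀ k, P (k + 2) = C (a k) * P (k + 1) - X * P k) {x s : ℂ} (hs : s ^ 2 * x = 1)
    (him : 0 < s.im) (k : ℕ) :
    0 < (s * aeval x (P (k + 1)) * (starRingEnd ℂ) (aeval x (P k))).im := by
  induction k with
  | zero => simpa [h0, h1] using mul_pos him hc
  | succ k ih =>
    have hs0 : s ≠ 0 := by rintro rfl; simp at him
    -- Here s x = 1/s, which is a positive multiple of the conjugate of s.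
    have hx : s * x = (Complex.normSq (s * x) : ℂ) * (starRingEnd ℂ) s := by
      have : (starRingEnd ℂ) s ^ 2 * (starRingEnd ℂ) x = 1 := by
        rw [← map_pow, ← map_mul, hs, map_one]
      rw [← Complex.mul_conj, map_mul]
      linear_combination (-s * x) * this
    have hpos : 0 < Complex.normSq (s * x) := by
      rw [Complex.normSq_pos]
      intro h
      rw [pow_two, mul_assoc, h] at hs; simp at hs
    generalize Complex.normSq (s * x) = w at hx hpos
    set u := aeval x (P k)
    set v := aeval x (P (k + 1)) with hv
    have hw : aeval x (P (k + 1 + 1)) = (a k : ℂ) * v - x * u := by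
      rw [show k + 1 + 1 = k + 2 by ring, hrec]
      simp [u, v]
    have hkey : s * aeval x (P (k + 1 + 1)) * (starRingEnd ℂ) v =
        ((a k * Complex.normSq v : ℝ) : ℂ) * s -
          (w : ℂ) * (starRingEnd ℂ) (s * v * (starRingEnd ℂ) u) := by
      rw [hw]
      push_cast
      rw [← Complex.mul_conj v]
      simp only [map_mul, Complex.conj_conj]
      linear_combination (-u * (starRingEnd ℂ) v) * hx
    rw [hkey, Complex.sub_im, Complex.im_ofReal_mul, Complex.im_ofReal_mul, Complex.conj_im]
    have := mul_pos hpos ih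
    have h3 := mul_nonneg (mul_nonneg (ha k).le (Complex.normSq_nonneg v)) him.le
    linarith

/-- The expression W_k is P_k² times the s-derivative of s P_{k+1}/P_k at x = s⁻². It satisfies
W_{k+1} = a_k P_{k+1}² + x W_k, and it vanishes at a double root of P_k. -/
lemma three_term_wronskian_pos (h0 : P 0 = 1) (h1 : P 1 = C c) (hc : 0 < c) (ha : ∀ k, 0 < a k)
    (hrec : ∀ k, P (k + 2) = C (a k) * P (k + 1) - X * P k) {x : ℝ} (hx : 0 < x) (k : ℕ) :
    0 < (P k).eval x * (P (k + 1)).eval x - 2 * x *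
      ((derivative (P (k + 1))).eval x * (P k).eval x -
        (derivative (P k)).eval x * (P (k + 1)).eval x) := by
  induction k with
  | zero => simpa [h0, h1] using hc
  | succ k ih =>
    rw [show k + 1 + 1 = k + 2 by ring, hrec k]
    simp only [derivative_sub, derivative_mul, derivative_C, derivative_X, eval_sub, eval_mul,
      eval_C, eval_X, eval_add, zero_mul, one_mul, eval_zero]
    have h2 := mul_nonneg (ha k).le (sq_nonneg ((P (k + 1)).eval x))
    have h3 := mul_pos hx ih
    nlinarith

lemma three_term_root_pos (h0 : P 0 = 1) (h1 : P 1 = C c) (hc : 0 < c) (ha : ∀ k, 0 < a k)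
    (hrec : ∀ k, P (k + 2) = C (a k) * P (k + 1) - X * P k) (k : ℕ)
    (hk : (P k).coeff 0 ≠ 0) {x : ℂ} (hx : aeval x (P k) = 0) :
    ∃ t : ℝ, 0 < t ∧ x = t := by
  have hx0 : x ≠ 0 := by
    rintro rfl
    rw [← coeff_zero_eq_aeval_zero'] at hx
    exact hk (by simpa using hx)
  obtain ⟨s, hs⟩ := IsAlgClosed.exists_pow_nat_eq x⁻¹ (n := 2) (by norm_num)
  have hsx : s ^ 2 * x = 1 := by rw [hs, inv_mul_cancel₀ hx0]
  -- Either sign of s may be used, so a nonreal s is excluded by the half-plane argument; a real s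
  -- gives x = s⁻² > 0.
  rcases lt_trichotomy s.im 0 with h | h | h
  · have := three_term_im_pos h0 h1 hc ha hrec (s := -s) (x := x) (by rw [neg_sq, hsx])
      (by simpa using h) k
    simp [hx] at this
  · have hsr : s = (s.re : ℂ) := by apply Complex.ext <;> simp [h]
    have hs0 : s.re ≠ 0 := by
      intro h'; rw [hsr, h'] at hsx; simp at hsx
    refine ⟨(s.re ^ 2)⁻¹, by positivity, ?_⟩
    push_cast
    rw [← hsr, hs, inv_inv]
  · have := three_term_im_pos h0 h1 hc ha hrec hsx h k
    simp [hx] at this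

lemma three_term_root_simple (h0 : P 0 = 1) (h1 : P 1 = C c) (hc : 0 < c) (ha : ∀ k, 0 < a k)
    (hrec : ∀ k, P (k + 2) = C (a k) * P (k + 1) - X * P k) (k : ℕ) {x : ℝ} (hx : 0 < x)
    (h : (P k).eval x = 0) : (derivative (P k)).eval x ≠ 0 := by
  intro h'
  have := three_term_wronskian_pos h0 h1 hc ha hrec hx k
  simp [h, h'] at this

end ThreeTerm

lemma exists_isIncreasingRoots {p : ℝ[X]} (hp : p ≠ 0)
    (hreal : ∀ z : ℂ, aeval z p = 0 → ∃ t : ℝ, z = t)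
    (hsimple : ∀ x : ℝ, p.eval x = 0 → (derivative p).eval x ≠ 0) :
    ∃ r : ℕ → ℝ, IsIncreasingRoots p p.natDegree r := by
  have hsplit : p.Splits := by
    refine Splits.of_splits_map (algebraMap ℝ ℂ) (IsAlgClosed.splits _) fun z hz ↦ ?_
    obtain ⟨t, rfl⟩ := hreal z (by
      rw [mem_roots'] at hz
      simpa [IsRoot, eval_map_algebraMap] using hz.2)
    exact ⟨t, rfl⟩
  have hnodup : p.roots.Nodup := by
    rw [Multiset.nodup_iff_count_le_one]
    intro x
    by_contra! hlt
    rw [count_roots] at hlt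
    have := (one_lt_rootMultiplicity_iff_isRoot hp).1 hlt
    exact hsimple x this.1 this.2
  have hcard : p.roots.toFinset.card = p.natDegree := by
    rw [Multiset.toFinset_card_of_nodup hnodup, ← hsplit.natDegree_eq_card_roots]
  set m := p.natDegree
  let f := p.roots.toFinset.orderEmbOfFin hcard
  let r : ℕ → ℝ := fun k ↦ if h : k - 1 < m then f ⟨k - 1, h⟩ else 0
  have hmono : StrictMonoOn r (Set.Icc 1 m) := by
    intro i hi j hj hij
    rw [Set.mem_Icc] at hi hj
    simp only [r, dif_pos (show i - 1 < m by omega), dif_pos (show j - 1 < m by omega)]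
    exact f.strictMono (by simp [Fin.lt_def]; omega)
  refine ⟨r, hp, hmono, ?_⟩
  have himage : (Finset.Icc 1 m).image r = p.roots.toFinset := by
    refine Finset.eq_of_subset_of_card_le ?_ ?_
    · intro y hy
      obtain ⟨k, hk, rfl⟩ := Finset.mem_image.1 hy
      rw [Finset.mem_Icc] at hk
      simp only [r, dif_pos (show k - 1 < m by omega)]
      exact Finset.orderEmbOfFin_mem _ hcard _
    · rw [hcard, Finset.card_image_of_injOn (by simpa using hmono.injOn)]
      simp
  conv_lhs => rw [hsplit.eq_prod_roots]
  rw [← Finset.prod_image (f := fun y ↦ X - C y) (by simpa using hmono.injOn), himage,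
    Finset.prod_eq_multiset_prod, Multiset.toFinset_val, hnodup.dedup]

lemma IsIncreasingRoots.eval_eq_zero_iff {p : ℝ[X]} {m : ℕ} {r : ℕ → ℝ}
    (h : IsIncreasingRoots p m r) (x : ℝ) : p.eval x = 0 ↔ ∃ k ∈ Finset.Icc 1 m, x = r k := by
  conv_lhs => rw [h.eq_prod]
  rw [eval_mul, eval_prod, mul_eq_zero, Finset.prod_eq_zero_iff]
  simp [sub_eq_zero, h.ne_zero]

/-! ### Real, simple, positive roots of F_n -/

lemma besselSection_coeff_zero_ne {e N : ℕ} (h : e ≤ N) : (besselSection e N).coeff 0 ≠ 0 := by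
  rw [besselSection_coeff]
  simpa using (besselCoeff_pos h).ne'

lemma besselSection_zero_zero : besselSection 0 0 = 1 := by
  simp [besselSection, besselCoeff]

lemma besselSection_zero_one : besselSection 0 1 = C 1 := by
  simp [besselSection, besselCoeff, Finset.sum_range_succ]

lemma besselSection_one_one : besselSection 1 1 = 1 := by
  simp [besselSection, besselCoeff, Finset.sum_range_succ]

lemma besselSection_one_two : besselSection 1 2 = C 3 := by
  simp [besselSection, besselCoeff, Finset.sum_range_succ, Nat.factorial]
  norm_num

lemma besselSection_root_pos {e N : ℕ} (he : e < 2) (hN : e ≤ N) {z : ℂ}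
    (hz : aeval z (besselSection e N) = 0) : ∃ t : ℝ, 0 < t ∧ z = t := by
  obtain ⟨k, rfl⟩ := Nat.exists_eq_add_of_le' hN
  interval_cases e
  · exact three_term_root_pos besselSection_zero_zero besselSection_zero_one one_pos
      (a := fun k ↦ 2 * (k : ℝ) + 3) (fun k ↦ by positivity)
      (fun k ↦ besselSection_recurrence he k) k (besselSection_coeff_zero_ne hN) hz
  -- The odd section of degree index 0 is zero, so the recurrence is started at N = 1.
  · exact three_term_root_pos (P := fun k ↦ besselSection 1 (k + 1)) besselSection_one_one
      besselSection_one_two (by norm_num)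
      (a := fun k ↦ 2 * ((k + 1 : ℕ) : ℝ) + 3) (fun k ↦ by positivity)
      (fun k ↦ besselSection_recurrence he (k + 1)) k (besselSection_coeff_zero_ne hN) hz

lemma besselSection_root_simple {e N : ℕ} (he : e < 2) (hN : e ≤ N) {x : ℝ} (hx : 0 < x)
    (h : (besselSection e N).eval x = 0) : (derivative (besselSection e N)).eval x ≠ 0 := by
  obtain ⟨k, rfl⟩ := Nat.exists_eq_add_of_le' hN
  interval_cases e
  · exact three_term_root_simple besselSection_zero_zero besselSection_zero_one one_pos
      (a := fun k ↦ 2 * (k : ℝ) + 3) (fun k ↦ by positivity)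
      (fun k ↦ besselSection_recurrence he k) k hx h
  · exact three_term_root_simple (P := fun k ↦ besselSection 1 (k + 1)) besselSection_one_one
      besselSection_one_two (by norm_num)
      (a := fun k ↦ 2 * ((k + 1 : ℕ) : ℝ) + 3) (fun k ↦ by positivity)
      (fun k ↦ besselSection_recurrence he (k + 1)) k hx h

lemma polyF_natDegree {e : ℕ} (he : e < 2) (m : ℕ) : (polyF (2 * m + e)).natDegree = m := by
  refine natDegree_eq_of_le_of_coeff_ne_zero ?_ ?_
  · rw [natDegree_le_iff_coeff_eq_zero]
    intro j hj
    rw [polyF_coeff he, besselCoeff_of_lt (by omega), mul_zero]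
  · rw [polyF_coeff he]
    exact mul_ne_zero (by simp) (besselCoeff_pos le_rfl).ne'

lemma polyF_coeff_zero_ne {e : ℕ} (he : e < 2) (m : ℕ) : (polyF (2 * m + e)).coeff 0 ≠ 0 := by
  rw [polyF_coeff he]
  exact mul_ne_zero (by simp) (besselCoeff_pos (by omega)).ne'

lemma polyF_root_pos {e : ℕ} (he : e < 2) (m : ℕ) {z : ℂ} (hz : aeval z (polyF (2 * m + e)) = 0) :
    ∃ t : ℝ, 0 < t ∧ z = t := by
  refine besselSection_root_pos he (N := 2 * m + e) (by omega) ?_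
  rw [polyF_eq he, map_mul] at hz
  simpa using hz

lemma polyF_real_root_pos {e : ℕ} (he : e < 2) (m : ℕ) {x : ℝ}
    (hx : (polyF (2 * m + e)).eval x = 0) : 0 < x := by
  obtain ⟨t, ht, h⟩ := polyF_root_pos he m (z := (x : ℂ)) (by
    rw [← Complex.coe_algebraMap, aeval_algebraMap_apply, coe_aeval_eq_eval, hx, map_zero])
  rw [Complex.ofReal_inj] at h
  exact h ▸ ht

lemma polyF_exists_roots {e : ℕ} (he : e < 2) (m : ℕ) :
    ∃ r : ℕ → ℝ, IsIncreasingRoots (polyF (2 * m + e)) m r := by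
  have h := exists_isIncreasingRoots (p := polyF (2 * m + e))
    (fun h ↦ polyF_coeff_zero_ne he m (by rw [h, coeff_zero]))
    (fun z hz ↦ (polyF_root_pos he m hz).imp fun t ht ↦ ht.2)
    (fun x hx ↦ by
      have h1 := besselSection_root_simple he (N := 2 * m + e) (by omega)
        (polyF_real_root_pos he m hx) (by
          rw [polyF_eq he, eval_mul] at hx
          simpa using hx)
      rw [polyF_eq he, derivative_C_mul, eval_mul]
      exact mul_ne_zero (by simp) h1)
  rwa [polyF_natDegree he] at h

/-! ### From convergence of coefficients to convergence of roots -/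

/-- Dominated convergence for series. The product filter lets the evaluation point move with n, as
needed at roots and critical points. -/
lemma tendsto_eval_of_tendsto_coeff {p : ℕ → ℝ[X]} {c : ℕ → ℝ}
    (hc : ∀ j, Tendsto (fun n ↦ (p n).coeff j) atTop (𝓝 (c j)))
    (hb : ∀ᶠ n in atTop, ∀ j, |(p n).coeff j| ≤ 1 / j.factorial) (x : ℝ) :
    Tendsto (fun q : ℕ × ℝ ↦ (p q.1).eval q.2) (atTop ×ˢ 𝓝 x) (𝓝 (∑' j, c j * x ^ j)) := by
  have heval : ∀ q : ℕ × ℝ, (p q.1).eval q.2 = ∑' j, (p q.1).coeff j * q.2 ^ j := by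
    intro q
    rw [eval_eq_sum_range, tsum_eq_sum]
    intro j hj
    rw [coeff_eq_zero_of_natDegree_lt (by simpa [Nat.lt_succ_iff] using hj), zero_mul]
  simp_rw [heval]
  refine tendsto_tsum_of_dominated_convergence (bound := fun j ↦ (|x| + 1) ^ j / j.factorial)
    (Real.summable_pow_div_factorial _) ?_ ?_
  · intro j
    exact ((hc j).comp tendsto_fst).mul (tendsto_snd.pow j)
  · have h1 : ∀ᶠ y in 𝓝 x, |y| ≤ |x| + 1 :=
      ((continuous_abs.tendsto x).eventually (gt_mem_nhds (lt_add_one _))).mono fun _ h ↦ h.le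
    filter_upwards [hb.prod_mk h1] with q hq j
    rw [Real.norm_eq_abs, abs_mul, abs_pow, div_eq_inv_mul, ← one_div]
    exact mul_le_mul (hq.1 j) (pow_le_pow_left₀ (abs_nonneg _) hq.2 j) (by positivity)
      (by positivity)

/-- If polynomials with positive real roots, together with their derivatives (multiplied by `x`),
converge continuously to `G` and `H`, where `G` has only simple positive zeros `μ k`, at which it
changes sign, then the `k`-th smallest root converges to `μ k`. -/
theorem tendsto_increasingRoots {p : ℕ → ℝ[X]} {lam : ℕ → ℕ → ℝ} {G H : ℝ → ℝ} {μ : ℕ → ℝ}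
    (hlam : ∀ n, IsIncreasingRoots (p n) n (lam n))
    (hpos : ∀ n x, (p n).eval x = 0 → 0 < x)
    {α : ℕ → ℝ} (hα : ∀ n, α n ≠ 0)
    (hG : ∀ x, Tendsto (fun q : ℕ × ℝ ↦ α q.1 * (p q.1).eval q.2) (atTop ×ˢ 𝓝 x) (𝓝 (G x)))
    (hH : ∀ x, Tendsto (fun q : ℕ × ℝ ↦ α q.1 * (q.2 * (derivative (p q.1)).eval q.2))
      (atTop ×ˢ 𝓝 x) (𝓝 (H x)))
    (hμ : StrictMonoOn μ (Set.Ici 1))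
    (hzero : ∀ x, 0 ≤ x → G x = 0 → ∃ k, 1 ≤ k ∧ x = μ k)
    (hsimple : ∀ k, 1 ≤ k → H (μ k) ≠ 0)
    (hsign : ∀ k, 1 ≤ k → ∀ ε > 0, ∃ a b, μ k - ε < a ∧ a < b ∧ b < μ k + ε ∧ G a * G b < 0)
    (k : ℕ) (hk : 1 ≤ k) : Tendsto (fun n ↦ lam n k) atTop (𝓝 (μ k)) := by
  have hroot : ∀ n, ∀ i ∈ Finset.Icc 1 n, (p n).eval (lam n i) = 0 := fun n i hi ↦
    ((hlam n).eval_eq_zero_iff _).2 ⟨i, hi, rfl⟩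
  induction k using Nat.strong_induction_on with
  | _ k ih =>
  have hupper : ∀ ε > 0, ∀ᶠ n in atTop, lam n k < μ k + ε := by
    -- By induction the earlier roots eventually lie left of μ k - δ, so a root produced by the sign
    -- change has index at least k.
    have haux : ∀ δ > 0, (∀ i, 1 ≤ i → i < k → μ i < μ k - δ) →
        ∀ᶠ n in atTop, lam n k < μ k + δ := by
      intro δ hδ hsep
      obtain ⟨a, b, ha, hab, hb, hneg⟩ := hsign k hk δ hδ
      have hpt : ∀ x : ℝ, Tendsto (fun n ↦ α n * (p n).eval x) atTop (𝓝 (G x)) := fun x ↦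
        (hG x).comp (tendsto_id.prodMk tendsto_const_nhds)
      have h1 : ∀ᶠ n in atTop, (α n * (p n).eval a) * (α n * (p n).eval b) < 0 :=
        ((hpt a).mul (hpt b)).eventually (gt_mem_nhds hneg)
      have h2 : ∀ᶠ n in atTop, ∀ i ∈ Finset.Ico 1 k, lam n i < μ k - δ := by
        rw [Filter.eventually_all_finset]
        intro i hi
        rw [Finset.mem_Ico] at hi
        exact (ih i hi.2 hi.1).eventually (gt_mem_nhds (hsep i hi.1 hi.2))
      filter_upwards [h1, h2, eventually_ge_atTop k] with n h1 h2 hn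
      have h3 : (p n).eval a * (p n).eval b < 0 := by
        have h4 : 0 < α n ^ 2 := by have := hα n; positivity
        by_contra! h5
        nlinarith [mul_nonneg h4.le h5]
      have hcont : ContinuousOn (fun x ↦ (p n).eval x) (Set.Icc a b) := (p n).continuous.continuousOn
      obtain ⟨y, hy, hy0⟩ : ∃ y ∈ Set.Icc a b, (p n).eval y = 0 := by
        rcases mul_neg_iff.1 h3 with h | h
        · exact intermediate_value_Icc' hab.le hcont ⟨h.2.le, h.1.le⟩
        · exact intermediate_value_Icc hab.le hcont ⟨h.1.le, h.2.le⟩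
      obtain ⟨i, hi, rfl⟩ := ((hlam n).eval_eq_zero_iff y).1 hy0
      rw [Finset.mem_Icc] at hi
      have hki : k ≤ i := by
        by_contra! hik
        have := h2 i (Finset.mem_Ico.2 ⟨hi.1, hik⟩)
        linarith [hy.1]
      have := (hlam n).strictMonoOn.monotoneOn ⟨hk, hn⟩ (Set.mem_Icc.2 hi) hki
      linarith [hy.2]
    intro ε hε
    have hev : ∀ᶠ δ in 𝓝[>] (0 : ℝ), ∀ i ∈ Finset.Ico 1 k, μ i < μ k - δ := by
      rw [Filter.eventually_all_finset]
      intro i hi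
      rw [Finset.mem_Ico] at hi
      have := hμ (Set.mem_Ici.2 hi.1) (Set.mem_Ici.2 hk) hi.2
      filter_upwards [nhdsWithin_le_nhds (gt_mem_nhds (sub_pos.2 this))] with δ hδ
      linarith
    obtain ⟨δ, hδ, hδε, hδ0⟩ := (hev.and (((gt_mem_nhds hε).filter_mono nhdsWithin_le_nhds).and
      self_mem_nhdsWithin)).exists
    refine (haux δ hδ0 fun i h1 h2 ↦ hδ i (Finset.mem_Ico.2 ⟨h1, h2⟩)).mono fun n hn ↦ ?_
    linarith
  -- By compactness each ultrafilter yields a limit L of the k-th roots; it remains to identify L.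
  refine (tendsto_iff_ultrafilter _ _ _).2 fun U hU ↦ ?_
  have hlower : ∀ᶠ n in atTop, 0 < lam n k := by
    filter_upwards [eventually_ge_atTop k] with n hn
    exact hpos n _ (hroot n k (Finset.mem_Icc.2 ⟨hk, hn⟩))
  have hmem : ∀ᶠ n in (U : Filter ℕ), lam n k ∈ Set.Icc 0 (μ k + 1) := by
    filter_upwards [hU hlower, hU (hupper 1 one_pos)] with n h1 h2
    exact ⟨h1.le, h2.le⟩
  obtain ⟨L, hL, hUL⟩ := isCompact_Icc.ultrafilter_le_nhds (U.map fun n ↦ lam n k)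
    (le_principal_iff.2 hmem)
  have hlim : Tendsto (fun n ↦ lam n k) U (𝓝 L) := hUL
  have hGL : G L = 0 := by
    refine tendsto_nhds_unique ((hG L).comp ((tendsto_id.mono_left hU).prodMk hlim)) ?_
    refine tendsto_const_nhds.congr' ?_
    filter_upwards [hU (eventually_ge_atTop k)] with n hn
    simp [hroot n k (Finset.mem_Icc.2 ⟨hk, hn⟩)]
  obtain ⟨j, hj, hLj⟩ := hzero L hL.1 hGL
  have hLk : L ≤ μ k := by
    refine le_of_forall_pos_le_add fun ε hε ↦ ?_
    exact le_of_tendsto hlim (((hupper ε hε).filter_mono hU).mono fun n hn ↦ hn.le)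
  have hjk : j ≤ k := by
    by_contra! h
    have := hμ (Set.mem_Ici.2 hk) (Set.mem_Ici.2 hj) h
    linarith
  rcases hjk.lt_or_eq with hlt | rfl
  -- If the j-th and k-th roots share the limit μ j, Rolle's critical points between them converge
  -- there too, forcing H (μ j) = 0.
  · exfalso
    have hex : ∀ n, ∃ y, k ≤ n → lam n j < y ∧ y < lam n k ∧ (derivative (p n)).eval y = 0 := by
      intro n
      by_cases hn : k ≤ n
      · obtain ⟨y, hy, hy'⟩ := exists_hasDerivAt_eq_zero (f := fun x ↦ (p n).eval x)
          ((hlam n).strictMonoOn ⟨hj, hlt.le.trans hn⟩ ⟨hk, hn⟩ hlt) (p n).continuous.continuousOn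
          (by simp only [hroot n k (Finset.mem_Icc.2 ⟨hk, hn⟩),
            hroot n j (Finset.mem_Icc.2 ⟨hj, hlt.le.trans hn⟩)])
          (fun x _ ↦ (p n).hasDerivAt x)
        exact ⟨y, fun _ ↦ ⟨hy.1, hy.2, hy'⟩⟩
      · exact ⟨0, fun h ↦ absurd h hn⟩
    choose y hy using hex
    have hge : ∀ᶠ n in (U : Filter ℕ), k ≤ n := hU (eventually_ge_atTop k)
    have hylim : Tendsto y U (𝓝 L) := by
      refine tendsto_of_tendsto_of_tendsto_of_le_of_le' ?_ hlim (hge.mono fun n hn ↦ (hy n hn).1.le)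
        (hge.mono fun n hn ↦ (hy n hn).2.1.le)
      rw [hLj]
      exact (ih j hlt hj).mono_left hU
    have hHL : H L = 0 := by
      refine tendsto_nhds_unique ((hH L).comp ((tendsto_id.mono_left hU).prodMk hylim)) ?_
      refine tendsto_const_nhds.congr' ?_
      filter_upwards [hge] with n hn
      simp [(hy n hn).2.2]
    exact hsimple j hj (hLj ▸ hHL)
  · exact hLj ▸ hlim

/-! ### Convergence of the normalized F_n -/

lemma polyF_coeff_ratio {e : ℕ} (he : e < 2) (m j : ℕ) :
    (polyF (2 * m + e)).coeff j / (polyF (2 * m + e)).coeff 0 =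
      (-1) ^ j * (besselCoeff (2 * m + e) (2 * j + e) / besselCoeff (2 * m + e) e) := by
  rw [polyF_coeff he, polyF_coeff he, pow_add]
  simp only [mul_zero, zero_add, add_zero]
  rw [mul_assoc, mul_div_mul_left _ _ (by simp), mul_div_assoc]

lemma tendsto_polyF_coeff_ratio {e : ℕ} (he : e < 2) (j : ℕ) :
    Tendsto (fun m ↦ (polyF (2 * m + e)).coeff j / (polyF (2 * m + e)).coeff 0) atTop
      (𝓝 ((-1) ^ j / ((2 * j + e).factorial : ℝ))) := by
  simp_rw [polyF_coeff_ratio he]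
  have h1 : Tendsto (fun m : ℕ ↦ 2 * m + e) atTop atTop :=
    tendsto_atTop_mono (f := id) (fun m ↦ by simp only [id]; omega) tendsto_id
  have h2 := ((tendsto_besselCoeff_ratio e (2 * j)).comp h1).const_mul ((-1 : ℝ) ^ j)
  rw [Nat.factorial_eq_one.2 (by omega), Nat.cast_one, mul_one_div] at h2
  exact h2

lemma abs_polyF_coeff_ratio_le {e : ℕ} (he : e < 2) {m : ℕ} (hm : 1 ≤ m) (j : ℕ) :
    |(polyF (2 * m + e)).coeff j / (polyF (2 * m + e)).coeff 0| ≤ 1 / ((2 * j).factorial : ℝ) := by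
  have hpos := besselCoeff_pos (show e ≤ 2 * m + e by omega)
  rw [polyF_coeff_ratio he, abs_mul, abs_pow, abs_neg, abs_one, one_pow, one_mul,
    abs_of_nonneg (div_nonneg (besselCoeff_nonneg _ _) hpos.le), div_le_iff₀' hpos]
  refine (besselCoeff_le _ e (2 * j) (by omega)).trans ?_
  rw [Nat.factorial_eq_one.2 (show e ≤ 1 by omega), Nat.cast_one]
  gcongr
  omega

/-- The slack between (2j)! and j! absorbs the factor j produced by x d/dx. -/
lemma mul_one_div_factorial_two_mul_le (j : ℕ) :
    (j : ℝ) * (1 / ((2 * j).factorial : ℝ)) ≤ 1 / (j.factorial : ℝ) := by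
  rw [mul_one_div, div_le_div_iff₀ (by positivity) (by positivity), one_mul]
  rcases Nat.eq_zero_or_pos j with rfl | h
  · simp
  · have h1 : (j + 1).factorial ≤ (2 * j).factorial := Nat.factorial_le (by omega)
    rw [Nat.factorial_succ] at h1
    exact_mod_cast (Nat.mul_le_mul_right _ (Nat.le_succ j)).trans h1

lemma coeff_X_mul_derivative (p : ℝ[X]) (j : ℕ) : (X * derivative p).coeff j = j * p.coeff j := by
  cases j with
  | zero => simp
  | succ j => rw [coeff_X_mul, coeff_derivative]; push_cast; ring

lemma tendsto_polyF_eval {e : ℕ} (he : e < 2) (x : ℝ) :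
    Tendsto (fun q : ℕ × ℝ ↦ ((polyF (2 * q.1 + e)).coeff 0)⁻¹ * (polyF (2 * q.1 + e)).eval q.2)
      (atTop ×ˢ 𝓝 x) (𝓝 (∑' j : ℕ, (-1) ^ j / ((2 * j + e).factorial : ℝ) * x ^ j)) := by
  have h := tendsto_eval_of_tendsto_coeff
    (p := fun m ↦ C ((polyF (2 * m + e)).coeff 0)⁻¹ * polyF (2 * m + e))
    (c := fun j ↦ (-1) ^ j / ((2 * j + e).factorial : ℝ)) ?_ ?_ x
  · simpa only [eval_mul, eval_C] using h
  · intro j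
    simp only [coeff_C_mul, inv_mul_eq_div]
    exact tendsto_polyF_coeff_ratio he j
  · filter_upwards [eventually_ge_atTop 1] with m hm j
    simp only [coeff_C_mul, inv_mul_eq_div]
    refine (abs_polyF_coeff_ratio_le he hm j).trans ?_
    gcongr
    omega

lemma tendsto_polyF_derivative_eval {e : ℕ} (he : e < 2) (x : ℝ) :
    Tendsto (fun q : ℕ × ℝ ↦ ((polyF (2 * q.1 + e)).coeff 0)⁻¹ *
        (q.2 * (derivative (polyF (2 * q.1 + e))).eval q.2))
      (atTop ×ˢ 𝓝 x) (𝓝 (∑' j : ℕ, j * ((-1) ^ j / ((2 * j + e).factorial : ℝ)) * x ^ j)) := by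
  have h := tendsto_eval_of_tendsto_coeff
    (p := fun m ↦ C ((polyF (2 * m + e)).coeff 0)⁻¹ * (X * derivative (polyF (2 * m + e))))
    (c := fun j ↦ j * ((-1) ^ j / ((2 * j + e).factorial : ℝ))) ?_ ?_ x
  · simpa only [eval_mul, eval_C, eval_X] using h
  · intro j
    simp only [coeff_C_mul, coeff_X_mul_derivative, inv_mul_eq_div, mul_div_assoc]
    exact (tendsto_polyF_coeff_ratio he j).const_mul _
  · filter_upwards [eventually_ge_atTop 1] with m hm j
    simp only [coeff_C_mul, coeff_X_mul_derivative, inv_mul_eq_div, mul_div_assoc]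
    rw [abs_mul, Nat.abs_cast]
    exact (mul_le_mul_of_nonneg_left (abs_polyF_coeff_ratio_le he hm j) (by positivity)).trans
      (mul_one_div_factorial_two_mul_le j)

/-! ### The limit functions in the variable x = y² -/

lemma hasSum_cos_sq (y : ℝ) :
    HasSum (fun j : ℕ ↦ (-1) ^ j / ((2 * j + 0).factorial : ℝ) * (y ^ 2) ^ j) (Real.cos y) := by
  convert! Real.hasSum_cos y using 2 with j
  rw [← pow_mul, add_zero]; ring

lemma hasSum_sin_sq {y : ℝ} (hy : y ≠ 0) :
    HasSum (fun j : ℕ ↦ (-1) ^ j / ((2 * j + 1).factorial : ℝ) * (y ^ 2) ^ j)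
      (Real.sin y / y) := by
  convert! (Real.hasSum_sin y).div_const y using 2 with j
  rw [← pow_mul, pow_succ y]; field_simp

/-- This is x d/dx of cos √x, obtained by shifting the sine series rather than by termwise
differentiation. -/
lemma hasSum_mul_cos_sq (y : ℝ) :
    HasSum (fun j : ℕ ↦ j * ((-1) ^ j / ((2 * j + 0).factorial : ℝ)) * (y ^ 2) ^ j)
      (-(y * Real.sin y / 2)) := by
  rw [← hasSum_nat_add_iff' 1, Finset.sum_range_one, Nat.cast_zero, zero_mul, zero_mul, sub_zero,
    show -(y * Real.sin y / 2) = -(y / 2) * Real.sin y by ring]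
  convert! (Real.hasSum_sin y).mul_left (-(y / 2)) using 2 with j
  rw [← pow_mul, add_zero, show 2 * (j + 1) = (2 * j + 1) + 1 by ring,
    Nat.factorial_succ (2 * j + 1)]
  push_cast
  field_simp
  ring

/-- Uses j/(2j+1)! = (1/(2j)! - 1/(2j+1)!)/2. -/
lemma hasSum_mul_sin_sq {y : ℝ} (hy : y ≠ 0) :
    HasSum (fun j : ℕ ↦ j * ((-1) ^ j / ((2 * j + 1).factorial : ℝ)) * (y ^ 2) ^ j)
      ((Real.cos y - Real.sin y / y) / 2) := by
  convert! ((hasSum_cos_sq y).sub (hasSum_sin_sq hy)).div_const 2 using 2 with j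
  rw [add_zero, Nat.factorial_succ (2 * j)]
  push_cast
  field_simp
  ring

lemma exists_sign_change {G : ℝ → ℝ} {y : ℝ} (hy : 0 < y)
    (hG : ∀ δ, 0 < δ → δ < y → δ < Real.pi → G ((y - δ) ^ 2) * G ((y + δ) ^ 2) < 0)
    {ε : ℝ} (hε : 0 < ε) :
    ∃ a b, y ^ 2 - ε < a ∧ a < b ∧ b < y ^ 2 + ε ∧ G a * G b < 0 := by
  have h1 : Tendsto (fun δ : ℝ ↦ (y - δ) ^ 2) (𝓝[>] 0) (𝓝 (y ^ 2)) := by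
    have : ContinuousAt (fun δ : ℝ ↦ (y - δ) ^ 2) 0 := by fun_prop
    simpa using this.tendsto.mono_left nhdsWithin_le_nhds
  have h2 : Tendsto (fun δ : ℝ ↦ (y + δ) ^ 2) (𝓝[>] 0) (𝓝 (y ^ 2)) := by
    have : ContinuousAt (fun δ : ℝ ↦ (y + δ) ^ 2) 0 := by fun_prop
    simpa using this.tendsto.mono_left nhdsWithin_le_nhds
  obtain ⟨δ, h1, h2, h3, h4, h5⟩ := ((h1.eventually (lt_mem_nhds (sub_lt_self _ hε))).and
    ((h2.eventually (gt_mem_nhds (lt_add_of_pos_right _ hε))).and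
    (((gt_mem_nhds hy).filter_mono nhdsWithin_le_nhds).and
    (((gt_mem_nhds Real.pi_pos).filter_mono nhdsWithin_le_nhds).and self_mem_nhdsWithin)))).exists
  have h5 : 0 < δ := h5
  exact ⟨_, _, h1, by nlinarith, h2, hG δ h5 h3 h4⟩

lemma strictMonoOn_sq_mul_pi {c : ℝ} (hc : c < 1) :
    StrictMonoOn (fun k : ℕ ↦ ((k : ℝ) - c) ^ 2 * Real.pi ^ 2) (Set.Ici 1) := by
  intro i hi j _ hij
  have h1 : (1 : ℝ) ≤ i := by exact_mod_cast hi
  have h2 : (i : ℝ) < j := by exact_mod_cast hij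
  have h3 : 0 < Real.pi ^ 2 := by positivity
  have h4 : ((i : ℝ) - c) ^ 2 < ((j : ℝ) - c) ^ 2 := pow_lt_pow_left₀ (by linarith) (by linarith) two_ne_zero
  exact mul_lt_mul_of_pos_right h4 h3

/-! ### Limits of the roots -/

theorem tendsto_polyF_roots_even {lam : ℕ → ℕ → ℝ}
    (hlam : ∀ n, IsIncreasingRoots (polyF (2 * n + 0)) n (lam n)) (k : ℕ) (hk : 1 ≤ k) :
    Tendsto (fun n ↦ lam n k) atTop (𝓝 (((k : ℝ) - 1 / 2) ^ 2 * Real.pi ^ 2)) := by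
  have hcos : ∀ k : ℕ, Real.cos (((k : ℝ) - 1 / 2) * Real.pi) = 0 := fun k ↦
    Real.cos_eq_zero_iff.2 ⟨(k : ℤ) - 1, by push_cast; ring⟩
  have hpos : ∀ k : ℕ, 1 ≤ k → 0 < ((k : ℝ) - 1 / 2) * Real.pi := fun k hk ↦ by
    have : (1 : ℝ) ≤ k := by exact_mod_cast hk
    exact mul_pos (by linarith) Real.pi_pos
  refine tendsto_increasingRoots (μ := fun k : ℕ ↦ ((k : ℝ) - 1 / 2) ^ 2 * Real.pi ^ 2) hlam
    (fun n x ↦ polyF_real_root_pos two_pos n)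
    (fun n ↦ inv_ne_zero (polyF_coeff_zero_ne two_pos n)) (tendsto_polyF_eval two_pos)
    (tendsto_polyF_derivative_eval two_pos) (strictMonoOn_sq_mul_pi (by norm_num)) ?_ ?_ ?_ k hk
  · intro x hx h
    rw [← Real.sq_sqrt hx, (hasSum_cos_sq _).tsum_eq, Real.cos_eq_zero_iff] at h
    obtain ⟨i, hi⟩ := h
    have h1 : (-1 : ℝ) < i := by
      by_contra! h
      nlinarith [Real.sqrt_nonneg x, Real.pi_pos]
    have h2 : -1 < i := by exact_mod_cast h1
    lift i to ℕ using by omega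
    -- Zeros of cosine are (2i+1)π/2 with i ≥ 0 here, hence the shift to k = i + 1.
    refine ⟨i + 1, by omega, ?_⟩
    rw [← Real.sq_sqrt hx, hi]
    push_cast
    ring
  · intro k hk
    rw [← mul_pow, (hasSum_mul_cos_sq _).tsum_eq]
    have h1 := Real.sin_sq_add_cos_sq (((k : ℝ) - 1 / 2) * Real.pi)
    rw [hcos] at h1
    have h2 : Real.sin (((k : ℝ) - 1 / 2) * Real.pi) ≠ 0 := by
      intro h; rw [h] at h1; norm_num at h1
    have := (hpos k hk).ne'
    exact neg_ne_zero.2 (div_ne_zero (mul_ne_zero this h2) two_ne_zero)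
  · intro k hk ε hε
    simp only [← mul_pow]
    refine exists_sign_change (hpos k hk) (fun δ h0 _ h2 ↦ ?_) hε
    rw [(hasSum_cos_sq _).tsum_eq, (hasSum_cos_sq _).tsum_eq, Real.cos_sub, Real.cos_add, hcos]
    have h3 := Real.sin_sq_add_cos_sq (((k : ℝ) - 1 / 2) * Real.pi)
    rw [hcos] at h3
    have h4 := pow_pos (Real.sin_pos_of_pos_of_lt_pi h0 h2) 2
    -- As cos y = 0, the product cos(y-δ) cos(y+δ) is -sin² y sin² δ = -sin² δ.
    linear_combination h4 - Real.sin δ ^ 2 * h3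

theorem tendsto_polyF_roots_odd {lam : ℕ → ℕ → ℝ}
    (hlam : ∀ n, IsIncreasingRoots (polyF (2 * n + 1)) n (lam n)) (k : ℕ) (hk : 1 ≤ k) :
    Tendsto (fun n ↦ lam n k) atTop (𝓝 ((k : ℝ) ^ 2 * Real.pi ^ 2)) := by
  have hpos : ∀ k : ℕ, 1 ≤ k → 0 < (k : ℝ) * Real.pi := fun k hk ↦ by
    have : 0 < k := hk
    positivity
  refine tendsto_increasingRoots (μ := fun k : ℕ ↦ (k : ℝ) ^ 2 * Real.pi ^ 2) hlam
    (fun n x ↦ polyF_real_root_pos one_lt_two n)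
    (fun n ↦ inv_ne_zero (polyF_coeff_zero_ne one_lt_two n)) (tendsto_polyF_eval one_lt_two)
    (tendsto_polyF_derivative_eval one_lt_two)
    (by simpa using strictMonoOn_sq_mul_pi (c := 0) one_pos) ?_ ?_ ?_ k hk
  · intro x hx h
    -- At 0 the quotient form is unavailable, but the series itself equals 1.
    have hx0 : x ≠ 0 := by
      rintro rfl
      rw [tsum_eq_single 0 (fun j hj ↦ by simp [hj])] at h
      simp at h
    have hs : 0 < √x := Real.sqrt_pos.2 (hx.lt_of_ne' hx0)
    rw [← Real.sq_sqrt hx, (hasSum_sin_sq hs.ne').tsum_eq,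
      div_eq_zero_iff, or_iff_left hs.ne', Real.sin_eq_zero_iff] at h
    obtain ⟨i, hi⟩ := h
    have h1 : (0 : ℝ) < i := by
      rw [← hi] at hs
      exact pos_of_mul_pos_left hs Real.pi_pos.le
    have h2 : 0 < i := by exact_mod_cast h1
    lift i to ℕ using h2.le
    refine ⟨i, by omega, ?_⟩
    rw [← Real.sq_sqrt hx, ← hi]
    push_cast
    ring
  · intro k hk
    rw [← mul_pow, (hasSum_mul_sin_sq (hpos k hk).ne').tsum_eq, Real.sin_nat_mul_pi]
    have h1 := Real.sin_sq_add_cos_sq ((k : ℝ) * Real.pi)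
    rw [Real.sin_nat_mul_pi] at h1
    have h2 : Real.cos ((k : ℝ) * Real.pi) ≠ 0 := by
      intro h; simp [h] at h1
    simpa using h2
  · intro k hk ε hε
    simp only [← mul_pow]
    refine exists_sign_change (hpos k hk) (fun δ h0 h1 h2 ↦ ?_) hε
    have h3 : 0 < (k : ℝ) * Real.pi - δ := sub_pos.2 h1
    have h4 : 0 < (k : ℝ) * Real.pi + δ := add_pos (hpos k hk) h0
    rw [(hasSum_sin_sq h3.ne').tsum_eq, (hasSum_sin_sq h4.ne').tsum_eq, div_mul_div_comm]
    refine div_neg_of_neg_of_pos ?_ (mul_pos h3 h4)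
    rw [Real.sin_sub, Real.sin_add, Real.sin_nat_mul_pi]
    have h5 := Real.sin_sq_add_cos_sq ((k : ℝ) * Real.pi)
    rw [Real.sin_nat_mul_pi] at h5
    have h6 := pow_pos (Real.sin_pos_of_pos_of_lt_pi h0 h2) 2
    linear_combination h6 - Real.sin δ ^ 2 * h5

lemma hasSum_complex_cos_of_sq_eq {z w : ℂ} (h : w ^ 2 = z) :
    HasSum (fun j : ℕ ↦ (-1 : ℂ) ^ j / ((2 * j).factorial : ℂ) * z ^ j) (Complex.cos w) := by
  convert! Complex.hasSum_cos w using 2 with j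
  rw [← h, ← pow_mul]; ring

lemma hasSum_complex_sinc_of_sq_eq {z w : ℂ} (h : w ^ 2 = z) :
    HasSum (fun j : ℕ ↦ (-1 : ℂ) ^ j / ((2 * j + 1).factorial : ℂ) * z ^ j)
      (if w = 0 then 1 else Complex.sin w / w) := by
  split_ifs with hw
  · subst hw
    obtain rfl : z = 0 := by simpa using h.symm
    convert! hasSum_single (f := fun j : ℕ ↦
      (-1 : ℂ) ^ j / ((2 * j + 1).factorial : ℂ) * (0 : ℂ) ^ j) 0 (fun j hj ↦ by simp [hj]) using 1
    simp
  · convert! (Complex.hasSum_sin w).div_const w using 2 with j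
    rw [← h, ← pow_mul, pow_succ w]; field_simp

theorem mainTheorem7 :
    -- the polynomials have the right number of distinct roots, all of them real
    (∀ n : ℕ, ∃ r : ℕ → ℝ, IsIncreasingRoots (polyF (2 * n)) n r) ∧
    (∀ n : ℕ, ∃ r : ℕ → ℝ, IsIncreasingRoots (polyF (2 * n + 1)) n r) ∧
    -- limits of the `k`-th smallest roots
    (∀ lam : ℕ → ℕ → ℝ, (∀ n : ℕ, IsIncreasingRoots (polyF (2 * n)) n (lam n)) →
      ∀ k : ℕ, 1 ≤ k →
        Tendsto (fun n : ℕ => lam n k) atTop (𝓝 (((k : ℝ) - 1 / 2) ^ 2 * Real.pi ^ 2))) ∧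
    (∀ lam : ℕ → ℕ → ℝ, (∀ n : ℕ, IsIncreasingRoots (polyF (2 * n + 1)) n (lam n)) →
      ∀ k : ℕ, 1 ≤ k →
        Tendsto (fun n : ℕ => lam n k) atTop (𝓝 ((k : ℝ) ^ 2 * Real.pi ^ 2))) ∧
    -- the limiting series, after normalizing the constant coefficient to `1`
    (∀ n : ℕ, (polyF n).coeff 0 ≠ 0) ∧
    (∀ j : ℕ, Tendsto (fun n : ℕ => (polyF (2 * n)).coeff j / (polyF (2 * n)).coeff 0) atTop
      (𝓝 ((-1 : ℝ) ^ j / ((2 * j).factorial : ℝ)))) ∧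
    (∀ j : ℕ, Tendsto (fun n : ℕ => (polyF (2 * n + 1)).coeff j / (polyF (2 * n + 1)).coeff 0)
      atTop (𝓝 ((-1 : ℝ) ^ j / ((2 * j + 1).factorial : ℝ)))) ∧
    -- their sums at `z`, where `w` is any square root of `z`
    (∀ z w : ℂ, w ^ 2 = z →
      HasSum (fun j : ℕ => (-1 : ℂ) ^ j / ((2 * j).factorial : ℂ) * z ^ j) (Complex.cos w)) ∧
    (∀ z w : ℂ, w ^ 2 = z →
      HasSum (fun j : ℕ => (-1 : ℂ) ^ j / ((2 * j + 1).factorial : ℂ) * z ^ j)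
        (if w = 0 then 1 else Complex.sin w / w)) := by
  refine ⟨polyF_exists_roots (e := 0) two_pos, polyF_exists_roots (e := 1) one_lt_two,
    fun lam hlam k hk ↦ tendsto_polyF_roots_even hlam k hk,
    fun lam hlam k hk ↦ tendsto_polyF_roots_odd hlam k hk, fun n ↦ ?_,
    tendsto_polyF_coeff_ratio (e := 0) two_pos, tendsto_polyF_coeff_ratio (e := 1) one_lt_two,
    fun z w h ↦ hasSum_complex_cos_of_sq_eq h, fun z w h ↦ hasSum_complex_sinc_of_sq_eq h⟩
  have h := polyF_coeff_zero_ne (Nat.mod_lt n two_pos) (n / 2)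
  rwa [Nat.div_add_mod] at h
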